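/- Let $\mathcal N=\{1,\dots,n\}$ be a set of products, $g:\mathcal N\to\{1,\dots,K\}$ a map assigning to each product its group, $\mathcal S$ a collection of subsets (assortments) of $\mathcal N$, and $\mathcal I_{\mathcal S}=\{(i,S): S\in\mathcal S,\ i\in S\}$. Let $\boldsymbol p_{\mathcal S}=(p_{i,S})_{(i,S)\in\mathcal I_{\mathcal S}}$ be a choice probability collection, i.e. $p_{i,S}\ge 0$ and $\sum_{i\in S}p_{i,S}=1$ for every $S\in\mathcal S$. For probability laws $F_1,\dots,F_n$ on $\mathbb R$ let $\Theta(F)$ be the set of joint laws of $\boldsymbol\epsilon=(\epsilon_1,\dots,\epsilon_n)$ with marginals $F_1,\dots,F_n$. The collection $\boldsymbol p_{\mathcal S}$ is representable by a grouped marginal distribution model (G-MDM) with grouping $g$ if there are $\boldsymbol\mu\in\mathbb R^n$ and laws $F_1,\dots,F_n$, each absolutely continuous, with finite first absolute moment and with a distribution function that is strictly increasing on its support, and with $F_i=\hat F_{g(i)}$ for laws $\hat F_1,\dots,\hat F_K$ attached to the groups, such that for every $S\in\mathcal S$ there is $\theta^*\in\Theta(F)$ attaining $\sup_{\theta\in\Theta(F)}\mathbb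 E_{\boldsymbol\epsilon\sim\theta}\big[\max_{i\in S}(\mu_i+\epsilon_i)\big]$ with $p_{i,S}=\mathbb P_{\boldsymbol\epsilon\sim\theta^*}\big(i=\arg\max_{j\in S}(\mu_j+\epsilon_j)\big)$ for all $i\in S$. Then $\boldsymbol p_{\mathcal S}$ is representable by a G-MDM with grouping $g$ if and only if there exist $\lambda:\mathcal S\to\mathbb R$ and $\boldsymbol\nu\in\mathbb R^n$ such that for all $(i,S),(j,T)\in\mathcal I_{\mathcal S}$ with $g(i)=g(j)$: $$\lambda(S)-\nu_i>\lambda(T)-\nu_j\ \text{ if } p_{i,S}<p_{j,T},\qquad \lambda(S)-\nu_i=\lambda(T)-\nu_j\ \text{ if } p_{i,S}=p_{j,T}\neq 0.$$ The class of representable collections is the same if the laws $\hat F_1,\dots,\hat F_K$ are moreover required to be pairwise distinct. Consequently, representability can be checked by a linear program: $\boldsymbol p_{\mathcal S}$ is representable if and only if the optimal value (in $[-\infty,+\infty]$) of the program that maximizes $\varepsilon$ over $(\lambda_S)_{S\in\mathcal S}$, $(\nu_i)_{i\in\mathcal N}$ and $\varepsilon$, subject for all $(i,S),(j,T)\in\mathcal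 I_{\mathcal S}$ with $g(i)=g(j)$ to $(\lambda_S-\nu_i)-(\lambda_T-\nu_j)-\varepsilon\ge 0$ if $p_{i,S}<p_{j,T}$ and $(\lambda_S-\nu_i)-(\lambda_T-\nu_j)=0$ if $p_{i,S}=p_{j,T}\ne0$, is strictly positive. This program has $O(n|\mathcal S|)$ variables (at most $3n|\mathcal S|$, when $\mathcal S\neq\emptyset$) and $O(n^2|\mathcal S|^2)$ constraints (at most $n^2|\mathcal S|^2$). -/

import Mathlib

open MeasureTheory ProbabilityTheory

namespace ChoiceModel

/-- The index set of all product-assortment pairs `(i, S)` with `S ∈ 𝒮` and `i ∈ S`;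
the products are the elements of `Fin n` and `𝒮` is the collection of observed assortments. -/
abbrev Pairs {n : ℕ} (𝒮 : Finset (Finset (Fin n))) : Type :=
  (S : {S : Finset (Fin n) // S ∈ 𝒮}) × {i : Fin n // i ∈ S.1}

namespace Pairs

variable {n : ℕ} {𝒮 : Finset (Finset (Fin n))}

/-- The assortment `S` of a pair `(i, S)`. -/
abbrev assortment (x : Pairs 𝒮) : {S : Finset (Fin n) // S ∈ 𝒮} := x.1

/-- The product `i` of a pair `(i, S)`. -/
abbrev product (x : Pairs 𝒮) : Fin n := x.2.1

end Pairs

/-- A choice probability collection: non-negative numbers `p_{i,S}`, one for each pair `(i, S)`,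
which sum to one over every assortment. -/
def IsChoiceCollection {n : ℕ} {𝒮 : Finset (Finset (Fin n))} (p : Pairs 𝒮 → ℝ) : Prop :=
  (∀ x, 0 ≤ p x) ∧ ∀ S : {S : Finset (Fin n) // S ∈ 𝒮}, ∑ i : {i : Fin n // i ∈ S.1}, p ⟨S, i⟩ = 1

/-- The standing assumption on the law of a noise term: an absolutely continuous probability
distribution on `ℝ` with finite first absolute moment, whose distribution function is strictly
increasing on the support. -/
structure IsAdmissibleMarginal (F : Measure ℝ) : Prop where
  isProbabilityMeasure : IsProbabilityMeasure F
  absolutelyContinuous : F ≪ volume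
  strictMonoOn_cdf : StrictMonoOn (fun x => cdf F x) F.support
  integrable_id : Integrable (fun x : ℝ => x) F

/-- The set `Θ` of all joint laws of the noise vector with the given marginals. -/
def jointLaws {n : ℕ} (F : Fin n → Measure ℝ) : Set (Measure (Fin n → ℝ)) :=
  {θ | IsProbabilityMeasure θ ∧ ∀ i, θ.map (fun ε => ε i) = F i}

/-- The expectation under `θ` of the maximal utility `max_{i ∈ S} (ν_i + ε_i)`. -/
noncomputable def expectedMaxUtility {n : ℕ} (ν : Fin n → ℝ) (S : Finset (Fin n))
    (hS : S.Nonempty) (θ : Measure (Fin n → ℝ)) : ℝ :=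
  ∫ ε, S.sup' hS (fun i => ν i + ε i) ∂θ

/-- The event `i = argmax_{j ∈ S} (ν_j + ε_j)`. -/
def argmaxEvent {n : ℕ} (ν : Fin n → ℝ) (S : Finset (Fin n)) (i : Fin n) : Set (Fin n → ℝ) :=
  {ε | ∀ j ∈ S, j ≠ i → ν j + ε j < ν i + ε i}

/-- The marginal distribution model with marginals `F` and deterministic utilities `ν` yields the
probabilities `p`: for every assortment `S`, some joint law that maximizes the expected maximal
utility over all joint laws with marginals `F` has `p_{i,S}` as the probability of choosing `i`. -/
def MDMYields {n : ℕ} {𝒮 : Finset (Finset (Fin n))} (F : Fin n → Measure ℝ) (ν : Fin n → ℝ)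
    (p : Pairs 𝒮 → ℝ) : Prop :=
  ∀ S : {S : Finset (Fin n) // S ∈ 𝒮}, ∃ hS : S.1.Nonempty, ∃ θ ∈ jointLaws F,
    IsMaxOn (expectedMaxUtility ν S.1 hS) (jointLaws F) θ ∧
      ∀ i : {i : Fin n // i ∈ S.1}, p ⟨S, i⟩ = θ.real (argmaxEvent ν S.1 i.1)

/-- `p` is representable by a marginal distribution model in which all the products of a group
have the same marginal; the group of the product `i` is `g i`. -/
def IsGroupedRepresentable {n K : ℕ} (g : Fin n → Fin K) {𝒮 : Finset (Finset (Fin n))}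
    (p : Pairs 𝒮 → ℝ) : Prop :=
  ∃ (F : Fin n → Measure ℝ) (ν : Fin n → ℝ), (∀ i, IsAdmissibleMarginal (F i)) ∧
    (∃ Fhat : Fin K → Measure ℝ, ∀ i, F i = Fhat (g i)) ∧ MDMYields F ν p

/-- As `IsGroupedRepresentable`, where moreover different groups have different marginals. -/
def IsDistinctGroupedRepresentable {n K : ℕ} (g : Fin n → Fin K) {𝒮 : Finset (Finset (Fin n))}
    (p : Pairs 𝒮 → ℝ) : Prop :=
  ∃ (F : Fin n → Measure ℝ) (ν : Fin n → ℝ), (∀ i, IsAdmissibleMarginal (F i)) ∧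
    (∃ Fhat : Fin K → Measure ℝ, Function.Injective Fhat ∧ ∀ i, F i = Fhat (g i)) ∧
      MDMYields F ν p

/-- A linear program in the variables `V` (unrestricted in sign): maximize `∑ v, obj v * x v`
subject to the inequalities `∑ v, ineqCoeff c v * x v ≥ ineqRhs c` (`c : I`) and the equations
`∑ v, eqCoeff c v * x v = eqRhs c` (`c : E`). -/
structure LinearProgram (V I E : Type) [Fintype V] [Finite I] [Finite E] where
  obj : V → ℝ
  ineqCoeff : I → V → ℝ
  ineqRhs : I → ℝ
  eqCoeff : E → V → ℝ
  eqRhs : E → ℝ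

namespace LinearProgram

variable {V I E : Type} [Fintype V] [Finite I] [Finite E]

/-- The feasible points. -/
def feasible (P : LinearProgram V I E) : Set (V → ℝ) :=
  {x | (∀ c, P.ineqRhs c ≤ ∑ v, P.ineqCoeff c v * x v) ∧
    ∀ c, ∑ v, P.eqCoeff c v * x v = P.eqRhs c}

/-- The optimal value: `⊥` for an infeasible program, `⊤` for an unbounded one. -/
noncomputable def value (P : LinearProgram V I E) : EReal :=
  ⨆ x ∈ P.feasible, ((∑ v, P.obj v * x v : ℝ) : EReal)

/-- The number of variables. -/
noncomputable def numVars (_P : LinearProgram V I E) : ℕ := Fintype.card V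

/-- The number of constraints. -/
noncomputable def numConstraints (_P : LinearProgram V I E) : ℕ := Nat.card I + Nat.card E

end LinearProgram

/-- The variables of the test program: `λ_S` for `S ∈ 𝒮`, `ν_i` for the products `i`, and `ε`. -/
abbrev TestVar {n : ℕ} (𝒮 : Finset (Finset (Fin n))) : Type :=
  {S : Finset (Fin n) // S ∈ 𝒮} ⊕ Fin n ⊕ Unit

/-- The ordered pairs `(i, S)`, `(j, T)` with `g i = g j` and `p_{i,S} < p_{j,T}`. -/
abbrev StrictRows {n K : ℕ} (g : Fin n → Fin K) {𝒮 : Finset (Finset (Fin n))}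
    (p : Pairs 𝒮 → ℝ) : Type :=
  {c : Pairs 𝒮 × Pairs 𝒮 // g c.1.product = g c.2.product ∧ p c.1 < p c.2}

/-- The ordered pairs `(i, S)`, `(j, T)` with `g i = g j` and `p_{i,S} = p_{j,T} ≠ 0`. -/
abbrev TieRows {n K : ℕ} (g : Fin n → Fin K) {𝒮 : Finset (Finset (Fin n))}
    (p : Pairs 𝒮 → ℝ) : Type :=
  {c : Pairs 𝒮 × Pairs 𝒮 // g c.1.product = g c.2.product ∧ p c.1 = p c.2 ∧ p c.1 ≠ 0}

/-- The coefficients of the linear form `(λ_S - ν_i) - (λ_T - ν_j)`. -/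
def gapCoeff {n : ℕ} {𝒮 : Finset (Finset (Fin n))} (x y : Pairs 𝒮) : TestVar 𝒮 → ℝ :=
  Pi.single (Sum.inl x.assortment) 1 - Pi.single (Sum.inr (Sum.inl x.product)) 1
    - (Pi.single (Sum.inl y.assortment) 1 - Pi.single (Sum.inr (Sum.inl y.product)) 1)

/-- The coefficients of the linear form `ε`. -/
def epsCoeff {n : ℕ} (𝒮 : Finset (Finset (Fin n))) : TestVar 𝒮 → ℝ :=
  Pi.single (Sum.inr (Sum.inr ())) 1

/-- The linear program: maximize `ε` subject to, for all `(i, S)` and `(j, T)` with `g i = g j`,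
`(λ_S - ν_i) - (λ_T - ν_j) - ε ≥ 0` if `p_{i,S} < p_{j,T}`, and
`(λ_S - ν_i) - (λ_T - ν_j) = 0` if `p_{i,S} = p_{j,T} ≠ 0`. -/
def testProgram {n K : ℕ} (g : Fin n → Fin K) {𝒮 : Finset (Finset (Fin n))}
    (p : Pairs 𝒮 → ℝ) : LinearProgram (TestVar 𝒮) (StrictRows g p) (TieRows g p) where
  obj := epsCoeff 𝒮
  ineqCoeff c := gapCoeff c.1.1 c.1.2 - epsCoeff 𝒮
  ineqRhs _ := 0
  eqCoeff c := gapCoeff c.1.1 c.1.2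
  eqRhs _ := 0

end ChoiceModel

/-!
For every level `l`, a maximum is at most `l` plus the sum of the positive parts of the excesses
over `l`, and the expectation of that bound depends on the marginals only. If the probabilities that
the utilities exceed `l` add up to one, there is a coupling under which exactly one utility exceeds
`l`; it attains the bound, and under every optimal coupling `i` is chosen with the probability that
its own utility exceeds `l`. Hence a choice probability is the tail of the marginal of `i` at the
threshold `l - ν i`, and within a group the thresholds decrease in the probabilities.

Conversely, given such thresholds, a piecewise linear increasing bijection of the line interpolates
the values that the distribution function must take, and clamping it to `[0, 1]` gives an admissible
law. Translating the law and the utilities of a group in opposite directions leaves the tails at the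
thresholds unchanged, so that the laws can be told apart by their means.
-/

namespace ChoiceModel

open Set Filter Topology
open scoped NNReal ENNReal


section Tail

variable {μ : Measure ℝ} [IsProbabilityMeasure μ]

lemma real_Ioi_eq_one_sub_cdf (μ : Measure ℝ) [IsProbabilityMeasure μ] (t : ℝ) :
    μ.real (Ioi t) = 1 - cdf μ t := by
  rw [← compl_Iic, probReal_compl_eq_one_sub measurableSet_Iic, cdf_eq_real]

lemma antitone_real_Ioi : Antitone fun t => μ.real (Ioi t) :=
  fun _ _ h => measureReal_mono (Ioi_subset_Ioi h)

lemma measure_Ioc_pos_iff {a b : ℝ} : 0 < μ (Ioc a b) ↔ cdf μ a < cdf μ b := by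
  have h := (cdf μ).measure_Ioc a b
  rw [measure_cdf] at h
  rw [h, ENNReal.ofReal_pos, sub_pos]

lemma continuous_cdf [NullSingletonClass μ] : Continuous (cdf μ) := by
  refine continuous_iff_continuousAt.2 fun x => ?_
  have hatom : μ {x} = 0 := measure_singleton x
  rw [← measure_cdf μ, StieltjesFunction.measure_singleton, ENNReal.ofReal_eq_zero,
    sub_nonpos] at hatom
  rw [(monotone_cdf μ).continuousAt_iff_leftLim_eq_rightLim, StieltjesFunction.rightLim_eq]
  exact ((monotone_cdf μ).leftLim_le le_rfl).antisymm hatom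

lemma continuous_real_Ioi [NullSingletonClass μ] : Continuous fun t => μ.real (Ioi t) := by
  simp only [real_Ioi_eq_one_sub_cdf]
  exact continuous_const.sub continuous_cdf

lemma tendsto_real_Ioi_atTop : Tendsto (fun t => μ.real (Ioi t)) atTop (𝓝 0) := by
  simpa only [real_Ioi_eq_one_sub_cdf, sub_self] using (tendsto_cdf_atTop μ).const_sub 1

lemma tendsto_real_Ioi_atBot : Tendsto (fun t => μ.real (Ioi t)) atBot (𝓝 1) := by
  simpa only [real_Ioi_eq_one_sub_cdf, sub_zero] using (tendsto_cdf_atBot μ).const_sub 1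

theorem strictAntiOn_real_Ioi [NullSingletonClass μ] (hμ : StrictMonoOn (cdf μ) μ.support) :
    StrictAntiOn (fun t => μ.real (Ioi t)) ((fun t => μ.real (Ioi t)) ⁻¹' Ioo 0 1) := by
  rintro a ⟨-, ha⟩ b ⟨hb, -⟩ hab
  change μ.real (Ioi b) < μ.real (Ioi a)
  -- Moving `a` down and `b` up to the support changes the measure of the interval by zero.
  obtain ⟨x, ⟨hxa, hx⟩, hmax⟩ : ∃ x, IsGreatest (Iic a ∩ μ.support) x := by
    refine ⟨_, (isClosed_Iic.inter Measure.isClosed_support).isGreatest_csSup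
      (Measure.nonempty_inter_support_of_pos ?_) (bddAbove_Iic.mono inter_subset_left)⟩
    simp only [real_Ioi_eq_one_sub_cdf, sub_lt_self_iff, cdf_eq_real] at ha
    exact (ENNReal.toReal_pos_iff.1 ha).1
  obtain ⟨y, ⟨hby, hy⟩, hmin⟩ : ∃ y, IsLeast (Ici b ∩ μ.support) y := by
    refine ⟨_, (isClosed_Ici.inter Measure.isClosed_support).isLeast_csInf
      (Measure.nonempty_inter_support_of_pos ?_) (bddBelow_Ici.mono inter_subset_left)⟩
    exact (ENNReal.toReal_pos_iff.1 hb).1.trans_le (measure_mono Ioi_subset_Ici_self)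
  have hxy : 0 < μ (Ioc x y) :=
    measure_Ioc_pos_iff.2 (hμ hx hy ((hxa.trans_lt hab).trans_le hby))
  rw [real_Ioi_eq_one_sub_cdf, real_Ioi_eq_one_sub_cdf, sub_lt_sub_iff_left,
    ← measure_Ioc_pos_iff, pos_iff_ne_zero]
  refine fun h₀ => hxy.ne' ?_
  refine measure_mono_null (fun t ht => ?_)
    (measure_union_null (measure_union_null h₀ (measure_singleton y))
      (Measure.measure_compl_support (μ := μ)))
  by_contra hmem
  simp only [mem_union, mem_Ioc, mem_singleton_iff, mem_compl_iff, not_or, not_not,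
    not_and_or, not_lt, not_le] at hmem
  obtain ⟨⟨hta | hbt, hty⟩, hts⟩ := hmem
  · exact (hmax ⟨hta, hts⟩).not_gt ht.1
  · exact hty (ht.2.antisymm (hmin ⟨hbt.le, hts⟩))

end Tail

lemma exists_sum_real_Ioi_eq {ι : Type*} {F : ι → Measure ℝ} [∀ i, IsProbabilityMeasure (F i)]
    [∀ i, NullSingletonClass (F i)] (ν : ι → ℝ) {S : Finset ι} {q : ℝ} (h₀ : 0 < q)
    (hq : q < S.card) : ∃ l, ∑ i ∈ S, (F i).real (Ioi (l - ν i)) = q := by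
  have hcont : Continuous fun l => ∑ i ∈ S, (F i).real (Ioi (l - ν i)) :=
    continuous_finsetSum _ fun i _ => continuous_real_Ioi.comp (continuous_sub_right (ν i))
  have htop : Tendsto (fun l => ∑ i ∈ S, (F i).real (Ioi (l - ν i))) atTop (𝓝 0) := by
    simpa [sub_eq_add_neg, Function.comp_def] using tendsto_finsetSum S fun i _ =>
      tendsto_real_Ioi_atTop.comp (tendsto_atTop_add_const_right atTop (-ν i) tendsto_id)
  have hbot : Tendsto (fun l => ∑ i ∈ S, (F i).real (Ioi (l - ν i))) atBot (𝓝 S.card) := by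
    simpa [sub_eq_add_neg, Function.comp_def] using tendsto_finsetSum S fun i _ =>
      tendsto_real_Ioi_atBot.comp (tendsto_atBot_add_const_right atBot (-ν i) tendsto_id)
  obtain ⟨u, hu⟩ := (htop.eventually (gt_mem_nhds h₀)).exists
  obtain ⟨v, hv⟩ := (hbot.eventually (lt_mem_nhds hq)).exists
  exact mem_range_of_exists_le_of_exists_ge hcont ⟨u, hu.le⟩ ⟨v, hv.le⟩


section Interpolation

lemma exists_lipschitz_orderIso_extension {C : ℝ≥0} {e : ℝ ≃o ℝ} (he : LipschitzWith C e)
    {m b c : ℝ} (hmb : m < b) (hc : e m < c) :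
    ∃ (C' : ℝ≥0) (e' : ℝ ≃o ℝ), LipschitzWith C' e' ∧ EqOn e' e (Iic m) ∧ e' b = c := by
  obtain ⟨k, hk, hkb⟩ : ∃ k : ℝ, 0 < k ∧ k * (b - m) = c - e m :=
    ⟨(c - e m) / (b - m), div_pos (sub_pos.2 hc) (sub_pos.2 hmb),
      div_mul_cancel₀ _ (sub_pos.2 hmb).ne'⟩
  let f (t : ℝ) : ℝ := e (min t m) + k * (max t m - m)
  have f_left {t : ℝ} (ht : t ≤ m) : f t = e t := by simp [f, ht]
  have f_right {t : ℝ} (ht : m ≤ t) : f t = e m + k * (t - m) := by simp [f, ht]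
  have hf : StrictMono f := by
    refine StrictMonoOn.Iic_union_Ici (a := m) (fun s hs t ht hst => ?_) fun s hs t ht hst => ?_
    · rw [f_left hs, f_left ht]
      exact e.strictMono hst
    · rw [f_right hs, f_right ht]
      gcongr
  have hsurj : Function.Surjective f := fun y => by
    rcases le_total y (e m) with hy | hy
    · exact ⟨e.symm y, by rw [f_left ((e.symm_apply_le).2 hy), e.apply_symm_apply]⟩
    · have hdiv : 0 ≤ (y - e m) / k := div_nonneg (sub_nonneg.2 hy) hk.le
      refine ⟨m + (y - e m) / k, ?_⟩
      rw [f_right (by linarith), add_sub_cancel_left, mul_div_cancel₀ _ hk.ne', add_sub_cancel]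
  have hlip : LipschitzWith (C * 1 + ‖k‖₊ * (1 + 0)) f :=
    (he.comp (LipschitzWith.id.min_const m)).add
      ((lipschitzWith_smul k).comp
        ((LipschitzWith.id.max_const m).sub (LipschitzWith.const m)))
  exact ⟨_, hf.orderIsoOfSurjective f hsurj, hlip, fun t ht => f_left ht,
    (f_right hmb.le).trans (by rw [hkb]; ring)⟩

theorem exists_lipschitz_orderIso_eqOn (s : Finset ℝ) {W : ℝ → ℝ} (hW : StrictMonoOn W s) :
    ∃ (C : ℝ≥0) (e : ℝ ≃o ℝ), LipschitzWith C e ∧ EqOn e W s := by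
  induction s using Finset.induction_on_max with
  | empty => exact ⟨1, OrderIso.refl ℝ, LipschitzWith.id, by simp⟩
  | insert b s hb ih =>
    rcases s.eq_empty_or_nonempty with rfl | hs
    · exact ⟨1, OrderIso.addRight (W b - b), (isometry_add_right _).lipschitz, by simp⟩
    · obtain ⟨C, e, he, heW⟩ := ih (hW.mono (by simp))
      have hm := s.max'_mem hs
      obtain ⟨C', e', he', hleft, hright⟩ :=
        exists_lipschitz_orderIso_extension he (c := W b) (hb _ hm)
          ((heW hm).trans_lt (hW (by simp [hm]) (by simp) (hb _ hm)))
      refine ⟨C', e', he', fun z hz => ?_⟩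
      obtain rfl | hz := Finset.mem_insert.1 hz
      · exact hright
      · rw [hleft (s.le_max' z hz), heW hz]

end Interpolation

section QuantileLaw

/-- The law of `e.symm U` for a uniform random variable `U` on `[0, 1]`; its distribution function
is `e`, clamped to `[0, 1]`, so that prescribing its tails amounts to prescribing values of `e`. -/
noncomputable def quantileLaw (e : ℝ ≃o ℝ) : Measure ℝ :=
  (volume.restrict (Icc 0 1)).map e.symm

variable (e : ℝ ≃o ℝ)

instance : IsProbabilityMeasure (quantileLaw e) :=
  have : IsProbabilityMeasure (volume.restrict (Icc (0 : ℝ) 1)) := ⟨by simp⟩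
  Measure.isProbabilityMeasure_map e.symm.monotone.measurable.aemeasurable

lemma quantileLaw_apply {B : Set ℝ} (hB : MeasurableSet B) :
    quantileLaw e B = volume (e '' B ∩ Icc 0 1) := by
  have he : Measurable e.symm := e.symm.monotone.measurable
  rw [quantileLaw, Measure.map_apply he hB, Measure.restrict_apply (he hB),
    e.image_eq_preimage_symm]

lemma cdf_quantileLaw (t : ℝ) : cdf (quantileLaw e) t = max (min 1 (e t)) 0 := by
  have himage : e '' Iic t ∩ Icc 0 1 = Icc 0 (min 1 (e t)) := by
    ext u
    simp only [OrderIso.image_Iic, mem_inter_iff, mem_Iic, mem_Icc, le_min_iff]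
    tauto
  rw [cdf_eq_real, measureReal_def, quantileLaw_apply e measurableSet_Iic, himage,
    Real.volume_Icc, sub_zero, ENNReal.toReal_ofReal']

lemma quantileLaw_ae_mem_Icc : ∀ᵐ x ∂quantileLaw e, x ∈ Icc (e.symm 0) (e.symm 1) := by
  refine (ae_map_iff e.symm.monotone.measurable.aemeasurable measurableSet_Icc).2 ?_
  filter_upwards [ae_restrict_mem measurableSet_Icc] with u hu
  exact ⟨e.symm.monotone hu.1, e.symm.monotone hu.2⟩

variable {e}

lemma quantileLaw_absolutelyContinuous {C : ℝ≥0} (he : LipschitzWith C e) :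
    quantileLaw e ≪ volume := by
  refine Measure.AbsolutelyContinuous.mk fun N hN hN0 => ?_
  have hnull : volume (e '' N) ≤ 0 := by
    simpa [hausdorffMeasure_real, hN0] using he.hausdorffMeasure_image_le (d := 1) zero_le_one N
  rw [quantileLaw_apply e hN]
  exact measure_mono_null inter_subset_left (le_zero_iff.1 hnull)

theorem isAdmissibleMarginal_quantileLaw {C : ℝ≥0} (he : LipschitzWith C e) :
    IsAdmissibleMarginal (quantileLaw e) where
  isProbabilityMeasure := inferInstance
  absolutelyContinuous := quantileLaw_absolutelyContinuous he
  strictMonoOn_cdf := by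
    have hsupport := Measure.support_subset_of_isClosed isClosed_Icc (quantileLaw_ae_mem_Icc e)
    have hcdf {t : ℝ} (ht : t ∈ (quantileLaw e).support) : cdf (quantileLaw e) t = e t := by
      obtain ⟨h₀, h₁⟩ := hsupport ht
      rw [cdf_quantileLaw, min_eq_right (e.le_symm_apply.1 h₁), max_eq_left (e.symm_apply_le.1 h₀)]
    intro t ht u hu htu
    simpa only [hcdf ht, hcdf hu] using e.strictMono htu
  integrable_id :=
    Integrable.of_bound (C := max |e.symm 0| |e.symm 1|) measurable_id.aestronglyMeasurable <| by
      filter_upwards [quantileLaw_ae_mem_Icc e] with x hx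
      exact abs_le_max_abs_abs hx.1 hx.2

end QuantileLaw

theorem exists_isAdmissibleMarginal_real_Ioi_eq {ι : Type*} [Finite ι] {z q : ι → ℝ}
    (hq : ∀ i, q i ∈ Icc 0 1) (hlt : ∀ i j, q i < q j → z j < z i)
    (heq : ∀ i j, q i = q j → q i ≠ 0 → z i = z j) :
    ∃ F : Measure ℝ, IsAdmissibleMarginal F ∧ ∀ i, F.real (Ioi (z i)) = q i := by
  obtain ⟨Q, hQ⟩ : ∃ Q : ℝ → ℝ, ∀ i, Q (z i) = q i :=
    ⟨Function.extend z q 0, Function.FactorsThrough.extend_apply (fun i j hz =>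
      le_antisymm (not_lt.1 fun h => (hlt j i h).ne hz) (not_lt.1 fun h => (hlt i j h).ne' hz)) 0⟩
  -- Any strictly increasing values `≥ 1` will do where `q` vanishes: they are clamped to `1`.
  let W (t : ℝ) : ℝ := if Q t = 0 then 1 + Real.exp t else 1 - Q t
  have hW : StrictMonoOn W (range z) := by
    rintro _ ⟨i, rfl⟩ _ ⟨j, rfl⟩ hij
    have hle : q j ≤ q i := not_lt.1 fun h => (hlt i j h).not_gt hij
    have hne : q i ≠ 0 → q j ≠ q i := fun h₀ h => hij.ne (heq i j h.symm h₀)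
    have hexp := Real.exp_strictMono hij
    have hexp₀ := Real.exp_pos (z j)
    have hj := (hq j).1
    simp only [W, hQ]
    grind
  obtain ⟨C, e, he, heW⟩ := exists_lipschitz_orderIso_eqOn (finite_range z).toFinset (W := W)
    (by simpa using hW)
  refine ⟨quantileLaw e, isAdmissibleMarginal_quantileLaw he, fun i => ?_⟩
  have hei : e (z i) = W (z i) := heW (by simp)
  have hexp := Real.exp_pos (z i)
  rw [real_Ioi_eq_one_sub_cdf, cdf_quantileLaw, hei]
  obtain ⟨h₀, h₁⟩ := hq i
  simp only [W, hQ]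
  grind


section Translation

lemma IsAdmissibleMarginal.nullSingletonClass {F : Measure ℝ} (hF : IsAdmissibleMarginal F) :
    NullSingletonClass F :=
  ⟨fun x => hF.absolutelyContinuous (measure_singleton x)⟩

lemma real_Ioi_map_add_right (F : Measure ℝ) (t z : ℝ) :
    (F.map (· + t)).real (Ioi z) = F.real (Ioi (z - t)) := by
  rw [map_measureReal_apply (measurable_add_const t) measurableSet_Ioi, preimage_add_const_Ioi]

lemma support_map_add_right_subset (F : Measure ℝ) (t : ℝ) :
    (F.map (· + t)).support ⊆ (· - t) ⁻¹' F.support := by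
  have hclosed : IsClosed ((· - t) ⁻¹' F.support) :=
    Measure.isClosed_support.preimage (continuous_sub_right t)
  refine Measure.support_subset_of_isClosed hclosed
    ((ae_map_iff (measurable_add_const t).aemeasurable hclosed.measurableSet).2 ?_)
  filter_upwards [Measure.support_mem_ae (μ := F)] with x hx
  simpa using hx

theorem IsAdmissibleMarginal.map_add_right {F : Measure ℝ} (hF : IsAdmissibleMarginal F) (t : ℝ) :
    IsAdmissibleMarginal (F.map (· + t)) where
  isProbabilityMeasure :=
    have := hF.isProbabilityMeasure
    Measure.isProbabilityMeasure_map (measurable_add_const t).aemeasurable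
  absolutelyContinuous := by
    simpa only [map_add_right_eq_self] using
      hF.absolutelyContinuous.map (measurable_add_const t)
  strictMonoOn_cdf := by
    have := hF.isProbabilityMeasure
    have := Measure.isProbabilityMeasure_map (μ := F) (measurable_add_const t).aemeasurable
    have hcdf (x : ℝ) : cdf (F.map (· + t)) x = cdf F (x - t) := by
      rw [← sub_right_inj (a := (1 : ℝ)), ← real_Ioi_eq_one_sub_cdf, ← real_Ioi_eq_one_sub_cdf,
        real_Ioi_map_add_right]
    intro x hx y hy hxy
    simpa only [hcdf] using hF.strictMonoOn_cdf (support_map_add_right_subset F t hx)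
      (support_map_add_right_subset F t hy) (sub_lt_sub_right hxy t)
  integrable_id := by
    have := hF.isProbabilityMeasure
    refine (integrable_map_measure aestronglyMeasurable_id
      (measurable_add_const t).aemeasurable).2 (hF.integrable_id.add (integrable_const t))

lemma integral_map_add_right {F : Measure ℝ} [IsProbabilityMeasure F]
    (hF : Integrable (fun x => x) F) (t : ℝ) : ∫ x, x ∂F.map (· + t) = ∫ x, x ∂F + t := by
  rw [integral_map (f := fun x => x) (measurable_add_const t).aemeasurable aestronglyMeasurable_id,
    integral_add hF (integrable_const t), integral_const, probReal_univ, one_smul]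

lemma exists_injective_map_add_right {ι : Type*} [Countable ι] {F : ι → Measure ℝ}
    [∀ i, IsProbabilityMeasure (F i)] (hF : ∀ i, Integrable (fun x => x) (F i)) :
    ∃ t : ι → ℝ, Function.Injective fun i => (F i).map (· + t i) := by
  obtain ⟨f, hf⟩ := exists_injective_nat ι
  let t (i : ι) : ℝ := f i - ∫ x, x ∂F i
  refine ⟨t, fun i j hij => hf ?_⟩
  have hmean (i : ι) : ∫ x, x ∂(F i).map (· + t i) = f i := by
    rw [integral_map_add_right (hF i), add_sub_cancel]
  exact_mod_cast (hmean i).symm.trans ((congrArg (fun μ => ∫ x, x ∂μ) hij).trans (hmean j))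

end Translation


section ExclusiveCoupling

variable {ι : Type*} [Fintype ι] {X : ι → Type*} [∀ i, MeasurableSpace (X i)]
  {μ : ∀ i, Measure (X i)} {A : ∀ i, Set (X i)}

lemma measure_smul_cond {Ω : Type*} [MeasurableSpace Ω] (P : Measure Ω) [IsFiniteMeasure P]
    (B : Set Ω) : P B • P[|B] = P.restrict B := by
  rcases eq_or_ne (P B) 0 with h | h
  · rw [h, zero_smul, Measure.restrict_eq_zero.2 h]
  · rw [ProbabilityTheory.cond, smul_smul, ENNReal.mul_inv_cancel h (measure_ne_top P B), one_smul]

open Classical in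
/-- The mixture, with weights `μ i (A i)`, of the product laws under which the `i`-th coordinate is
conditioned to lie in `A i` and every other coordinate `j` to avoid `A j`. When the weights add up
to one it is a coupling of the laws `μ i` that makes exactly one of the events `ε i ∈ A i` occur. -/
noncomputable def exclusiveCoupling (μ : ∀ i, Measure (X i)) (A : ∀ i, Set (X i)) :
    Measure (∀ i, X i) :=
  ∑ i, μ i (A i) • Measure.pi fun j => (μ j)[|if j = i then A j else (A j)ᶜ]

variable [∀ i, IsProbabilityMeasure (μ i)] (hA : ∀ i, MeasurableSet (A i))
  (hsum : ∑ i, μ i (A i) = 1)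

include hA hsum

open Classical in
lemma sum_erase_measure_eq_measure_compl (j : ι) :
    ∑ i ∈ Finset.univ.erase j, μ i (A i) = μ j (A j)ᶜ := by
  rw [prob_compl_eq_one_sub (hA j), ← hsum, ← Finset.add_sum_erase _ _ (Finset.mem_univ j),
    ENNReal.add_sub_cancel_left (measure_ne_top _ _)]

open Classical in
lemma isProbabilityMeasure_cond_ite {i : ι} (hi : μ i (A i) ≠ 0) (j : ι) :
    IsProbabilityMeasure (μ j)[|if j = i then A j else (A j)ᶜ] := by
  split_ifs with h
  · exact cond_isProbabilityMeasure (h ▸ hi)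
  · refine cond_isProbabilityMeasure fun h₀ => hi ?_
    rw [← sum_erase_measure_eq_measure_compl hA hsum j] at h₀
    exact Finset.sum_eq_zero_iff.1 h₀ i (by simp [Ne.symm h])

lemma measurePreserving_eval_exclusiveCoupling (j : ι) :
    MeasurePreserving (Function.eval j) (exclusiveCoupling μ A) (μ j) := by
  classical
  refine ⟨measurable_pi_apply j, ?_⟩
  have hterm (i : ι) : (μ i (A i) • Measure.pi fun j =>
        (μ j)[|if j = i then A j else (A j)ᶜ]).map (Function.eval j) =
      μ i (A i) • (μ j)[|if j = i then A j else (A j)ᶜ] := by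
    rcases eq_or_ne (μ i (A i)) 0 with hi | hi
    · simp [hi]
    · have := isProbabilityMeasure_cond_ite hA hsum hi
      rw [Measure.map_smul, (measurePreserving_eval _ j).map_eq]
  calc (exclusiveCoupling μ A).map (Function.eval j)
      = ∑ i, μ i (A i) • (μ j)[|if j = i then A j else (A j)ᶜ] := by
        rw [exclusiveCoupling, Measure.map_finset_sum (measurable_pi_apply j).aemeasurable]
        exact Finset.sum_congr rfl fun i _ => hterm i
    _ = μ j (A j) • (μ j)[|A j] + ∑ i ∈ Finset.univ.erase j, μ i (A i) • (μ j)[|(A j)ᶜ] := by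
        rw [← Finset.add_sum_erase _ _ (Finset.mem_univ j), if_pos rfl]
        congr 1
        refine Finset.sum_congr rfl fun i hi => ?_
        rw [if_neg (Finset.ne_of_mem_erase hi).symm]
    _ = μ j := by
        rw [← Finset.sum_smul, sum_erase_measure_eq_measure_compl hA hsum, measure_smul_cond,
          measure_smul_cond, Measure.restrict_add_restrict_compl (hA j)]

lemma isProbabilityMeasure_exclusiveCoupling : IsProbabilityMeasure (exclusiveCoupling μ A) := by
  obtain ⟨j, -, -⟩ := Finset.exists_ne_zero_of_sum_ne_zero (hsum.trans_ne one_ne_zero)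
  have hj := measurePreserving_eval_exclusiveCoupling hA hsum j
  exact ⟨by rw [← preimage_univ, hj.measure_preimage nullMeasurableSet_univ, measure_univ]⟩

lemma ae_existsUnique_exclusiveCoupling :
    ∀ᵐ ε ∂exclusiveCoupling μ A, ∃! i, ε i ∈ A i := by
  classical
  rw [exclusiveCoupling, ae_finsetSum_measure_iff]
  intro i _
  rcases eq_or_ne (μ i (A i)) 0 with hi | hi
  · simp [hi]
  have := isProbabilityMeasure_cond_ite hA hsum hi
  refine Measure.ae_smul_measure ?_ _
  have hmem (j : ι) : ∀ᵐ ε ∂Measure.pi fun j => (μ j)[|if j = i then A j else (A j)ᶜ],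
      ε j ∈ if j = i then A j else (A j)ᶜ :=
    (measurePreserving_eval _ j).quasiMeasurePreserving.ae
      (ae_cond_mem (by split_ifs <;> measurability))
  filter_upwards [ae_all_iff.2 hmem] with ε hε
  refine ⟨i, by simpa using hε i, fun j hj => ?_⟩
  by_contra hji
  simpa [hji, hj] using hε j

end ExclusiveCoupling

section Duality

variable {ι : Type*} {S : Finset ι} {u : ι → ℝ} {l : ℝ}

lemma sup'_le_add_sum_posPart (hS : S.Nonempty) (u : ι → ℝ) (l : ℝ) :
    S.sup' hS u ≤ l + ∑ i ∈ S, (u i - l)⁺ := by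
  refine Finset.sup'_le hS _ fun j hj => ?_
  have hsingle := Finset.single_le_sum (f := fun i => (u i - l)⁺) (fun i _ => posPart_nonneg _) hj
  linarith [le_posPart (u j - l)]

lemma sup'_eq_add_sum_posPart_iff (hS : S.Nonempty) :
    S.sup' hS u = l + ∑ i ∈ S, (u i - l)⁺ ↔
      ∃ i ∈ S, l ≤ u i ∧ ∀ j ∈ S, j ≠ i → u j ≤ l := by
  classical
  constructor
  · intro h
    obtain ⟨k, hk, hku⟩ := S.exists_mem_eq_sup' hS u
    have hnonneg (T : Finset ι) : 0 ≤ ∑ i ∈ T, (u i - l)⁺ :=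
      Finset.sum_nonneg fun _ _ => posPart_nonneg _
    refine ⟨k, hk, by linarith [hnonneg S], fun j hj hjk => ?_⟩
    have hrest : ∑ i ∈ S.erase k, (u i - l)⁺ = 0 := by
      have hsplit := Finset.add_sum_erase S (fun i => (u i - l)⁺) hk
      linarith [hnonneg (S.erase k), le_posPart (u k - l)]
    have hj₀ := (Finset.sum_eq_zero_iff_of_nonneg fun _ _ => posPart_nonneg _).1 hrest j
      (Finset.mem_erase.2 ⟨hjk, hj⟩)
    exact sub_nonpos.1 (posPart_eq_zero.1 hj₀)
  · rintro ⟨i, hi, hli, hother⟩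
    refine le_antisymm (sup'_le_add_sum_posPart hS u l) ?_
    rw [Finset.sum_eq_single_of_mem i hi fun j hj hji =>
      posPart_eq_zero.2 (sub_nonpos.2 (hother j hj hji)), posPart_eq_self.2 (sub_nonneg.2 hli),
      add_sub_cancel]
    exact Finset.le_sup' u hi

end Duality


section Optimality

variable {n : ℕ} {F : Fin n → Measure ℝ} {θ : Measure (Fin n → ℝ)} {ν : Fin n → ℝ}
  {S : Finset (Fin n)} {l : ℝ}

/-- The objective of the one-dimensional convex program dual to the maximization of the expected
maximal utility over the joint laws with marginals `F`. -/
noncomputable def dualObjective (F : Fin n → Measure ℝ) (ν : Fin n → ℝ) (S : Finset (Fin n))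
    (l : ℝ) : ℝ :=
  l + ∑ i ∈ S, ∫ x, (ν i + x - l)⁺ ∂F i

lemma measurePreserving_eval_of_mem_jointLaws (hθ : θ ∈ jointLaws F) (i : Fin n) :
    MeasurePreserving (fun ε : Fin n → ℝ => ε i) θ (F i) :=
  ⟨measurable_pi_apply i, hθ.2 i⟩

lemma exists_mem_jointLaws_ae_existsUnique [∀ i, IsProbabilityMeasure (F i)]
    (hl : ∑ i ∈ S, (F i).real (Ioi (l - ν i)) = 1) :
    ∃ θ ∈ jointLaws F, ∀ᵐ ε ∂θ, ∃! i, i ∈ S ∧ l < ν i + ε i := by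
  let A (i : Fin n) : Set ℝ := if i ∈ S then Ioi (l - ν i) else ∅
  have hA (i : Fin n) : MeasurableSet (A i) := by
    simp only [A]
    split_ifs
    exacts [measurableSet_Ioi, .empty]
  have hAS (i : Fin n) : (F i).real (A i) = if i ∈ S then (F i).real (Ioi (l - ν i)) else 0 := by
    by_cases hi : i ∈ S <;> simp [A, hi]
  have hsum : ∑ i, F i (A i) = 1 := by
    rw [← ENNReal.toReal_eq_one_iff, ENNReal.toReal_sum fun i _ => measure_ne_top _ _]
    simpa only [← measureReal_def, hAS, Finset.sum_ite_mem, Finset.univ_inter] using hl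
  refine ⟨exclusiveCoupling F A, ⟨isProbabilityMeasure_exclusiveCoupling hA hsum, fun i =>
    (measurePreserving_eval_exclusiveCoupling hA hsum i).map_eq⟩, ?_⟩
  filter_upwards [ae_existsUnique_exclusiveCoupling hA hsum] with ε hε
  refine (existsUnique_congr fun i => ?_).1 hε
  by_cases hi : i ∈ S <;> simp [A, hi, sub_lt_iff_lt_add']

lemma measureReal_argmaxEvent_of_ae [∀ i, NullSingletonClass (F i)] (hθ : θ ∈ jointLaws F)
    (hae : ∀ᵐ ε ∂θ, ∃ i ∈ S, l ≤ ν i + ε i ∧ ∀ j ∈ S, j ≠ i → ν j + ε j ≤ l)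
    {i : Fin n} (hi : i ∈ S) :
    θ.real (argmaxEvent ν S i) = (F i).real (Ioi (l - ν i)) := by
  have hne : ∀ᵐ ε ∂θ, ∀ j, ν j + ε j ≠ l := ae_all_iff.2 fun j => by
    filter_upwards [(measurePreserving_eval_of_mem_jointLaws hθ j).quasiMeasurePreserving.ae
      (Measure.ae_ne (F j) (l - ν j))] with ε hε
    exact mt eq_sub_of_add_eq' hε
  have hevent : argmaxEvent ν S i =ᵐ[θ] (fun ε : Fin n → ℝ => ε i) ⁻¹' Ioi (l - ν i) := by
    filter_upwards [hae, hne] with ε ⟨k, hk, hlk, hother⟩ hne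
    change (ε ∈ argmaxEvent ν S i) = (l - ν i < ε i)
    rw [sub_lt_iff_lt_add']
    refine propext ⟨fun hmax => ?_, fun hli j hj hji => ?_⟩
    · rcases eq_or_ne k i with rfl | hki
      exacts [hlk.lt_of_ne' (hne k), hlk.trans_lt (hmax k hk hki)]
    · obtain rfl : i = k := by_contra fun hik => (hother i hi hik).not_gt hli
      exact (hother j hj hji).trans_lt hli
  rw [measureReal_congr hevent, measureReal_def,
    (measurePreserving_eval_of_mem_jointLaws hθ i).measure_preimage
      measurableSet_Ioi.nullMeasurableSet, measureReal_def]

section Integrable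

variable (hF : ∀ i, Integrable (fun x => x) (F i))

include hF

lemma integrable_add_eval (hθ : θ ∈ jointLaws F) (ν : Fin n → ℝ) (i : Fin n) :
    Integrable (fun ε => ν i + ε i) θ :=
  have := hθ.1
  (integrable_const (ν i)).add
    ((measurePreserving_eval_of_mem_jointLaws hθ i).integrable_comp_of_integrable (hF i))

lemma integrable_sup' (hθ : θ ∈ jointLaws F) (hS : S.Nonempty) :
    Integrable (fun ε => S.sup' hS fun i => ν i + ε i) θ := by
  have hsup : Integrable (S.sup' hS fun i (ε : Fin n → ℝ) => ν i + ε i) θ :=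
    Finset.sup'_induction hS _ (p := fun f => Integrable f θ) (fun _ h₁ _ h₂ => h₁.sup h₂)
      fun i _ => integrable_add_eval hF hθ ν i
  exact hsup.congr (ae_of_all _ fun ε => Finset.sup'_apply hS _ ε)

lemma integrable_posPart (hθ : θ ∈ jointLaws F) (i : Fin n) :
    Integrable (fun ε => (ν i + ε i - l)⁺) θ :=
  have := hθ.1
  ((integrable_add_eval hF hθ ν i).sub (integrable_const l)).pos_part

lemma integrable_add_sum_posPart (hθ : θ ∈ jointLaws F) :
    Integrable (fun ε => l + ∑ i ∈ S, (ν i + ε i - l)⁺) θ :=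
  have := hθ.1
  (integrable_const l).add (integrable_finsetSum _ fun _ _ => integrable_posPart hF hθ _)

lemma integral_add_sum_posPart (hθ : θ ∈ jointLaws F) :
    ∫ ε, (l + ∑ i ∈ S, (ν i + ε i - l)⁺) ∂θ = dualObjective F ν S l := by
  have := hθ.1
  have hmap (i : Fin n) : ∫ ε, (ν i + ε i - l)⁺ ∂θ = ∫ x, (ν i + x - l)⁺ ∂F i := by
    rw [← hθ.2 i, integral_map (measurable_pi_apply i).aemeasurable]
    exact (by fun_prop : Continuous fun x : ℝ => max (ν i + x - l) 0).aestronglyMeasurable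
  rw [integral_add (integrable_const l)
      (integrable_finsetSum _ fun _ _ => integrable_posPart hF hθ _),
    integral_finsetSum _ fun _ _ => integrable_posPart hF hθ _, integral_const, probReal_univ,
    one_smul, dualObjective]
  simp only [hmap]

lemma expectedMaxUtility_le_dualObjective (hθ : θ ∈ jointLaws F) (hS : S.Nonempty) :
    expectedMaxUtility ν S hS θ ≤ dualObjective F ν S l := by
  rw [← integral_add_sum_posPart hF hθ]
  exact integral_mono (integrable_sup' hF hθ hS) (integrable_add_sum_posPart hF hθ)
    fun ε => sup'_le_add_sum_posPart hS _ l

lemma expectedMaxUtility_eq_dualObjective_iff (hθ : θ ∈ jointLaws F) (hS : S.Nonempty) :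
    expectedMaxUtility ν S hS θ = dualObjective F ν S l ↔
      ∀ᵐ ε ∂θ, ∃ i ∈ S, l ≤ ν i + ε i ∧ ∀ j ∈ S, j ≠ i → ν j + ε j ≤ l := by
  rw [← integral_add_sum_posPart hF hθ, expectedMaxUtility,
    integral_eq_iff_of_ae_le (integrable_sup' hF hθ hS) (integrable_add_sum_posPart hF hθ)
      (ae_of_all _ fun ε => sup'_le_add_sum_posPart hS _ l)]
  exact eventually_congr (Eventually.of_forall fun ε => sup'_eq_add_sum_posPart_iff hS)

variable [∀ i, IsProbabilityMeasure (F i)] (hl : ∑ i ∈ S, (F i).real (Ioi (l - ν i)) = 1)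

include hl

lemma exists_mem_jointLaws_expectedMaxUtility_eq (hS : S.Nonempty) :
    ∃ θ ∈ jointLaws F, expectedMaxUtility ν S hS θ = dualObjective F ν S l := by
  obtain ⟨θ, hθ, hae⟩ := exists_mem_jointLaws_ae_existsUnique hl
  refine ⟨θ, hθ, (expectedMaxUtility_eq_dualObjective_iff hF hθ hS).2 ?_⟩
  filter_upwards [hae] with ε ⟨i, ⟨hi, hli⟩, hunique⟩
  exact ⟨i, hi, hli.le, fun j hj hji => not_lt.1 fun hlj => hji (hunique j ⟨hj, hlj⟩)⟩

lemma isMaxOn_expectedMaxUtility_iff (hθ : θ ∈ jointLaws F) (hS : S.Nonempty) :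
    IsMaxOn (expectedMaxUtility ν S hS) (jointLaws F) θ ↔
      expectedMaxUtility ν S hS θ = dualObjective F ν S l := by
  constructor
  · intro hmax
    obtain ⟨θ₀, hθ₀, h₀⟩ := exists_mem_jointLaws_expectedMaxUtility_eq hF hl hS
    exact (expectedMaxUtility_le_dualObjective hF hθ hS).antisymm (h₀.ge.trans (hmax hθ₀))
  · intro h θ' hθ'
    exact (expectedMaxUtility_le_dualObjective hF hθ' hS).trans h.ge

lemma exists_isMaxOn_expectedMaxUtility (hS : S.Nonempty) :
    ∃ θ ∈ jointLaws F, IsMaxOn (expectedMaxUtility ν S hS) (jointLaws F) θ := by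
  obtain ⟨θ, hθ, h⟩ := exists_mem_jointLaws_expectedMaxUtility_eq hF hl hS
  exact ⟨θ, hθ, (isMaxOn_expectedMaxUtility_iff hF hl hθ hS).2 h⟩

theorem measureReal_argmaxEvent_of_isMaxOn [∀ i, NullSingletonClass (F i)] (hθ : θ ∈ jointLaws F)
    (hS : S.Nonempty) (hmax : IsMaxOn (expectedMaxUtility ν S hS) (jointLaws F) θ)
    {i : Fin n} (hi : i ∈ S) : θ.real (argmaxEvent ν S i) = (F i).real (Ioi (l - ν i)) :=
  measureReal_argmaxEvent_of_ae hθ ((expectedMaxUtility_eq_dualObjective_iff hF hθ hS).1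
    ((isMaxOn_expectedMaxUtility_iff hF hl hθ hS).1 hmax)) hi

end Integrable

end Optimality


section Characterization

variable {n K : ℕ} {g : Fin n → Fin K} {𝒮 : Finset (Finset (Fin n))} {p : Pairs 𝒮 → ℝ}
  {F : Fin n → Measure ℝ} {ν : Fin n → ℝ} {S : {S : Finset (Fin n) // S ∈ 𝒮}}

section ChoiceCollection

variable (hp : IsChoiceCollection p)

include hp

lemma IsChoiceCollection.le_one (x : Pairs 𝒮) : p x ≤ 1 := by
  rw [← hp.2 x.1]
  exact Finset.single_le_sum (f := fun i => p ⟨x.1, i⟩) (fun _ _ => hp.1 _) (Finset.mem_univ x.2)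

lemma IsChoiceCollection.nonempty (S : {S : Finset (Fin n) // S ∈ 𝒮}) : S.1.Nonempty := by
  obtain ⟨i, -, -⟩ := Finset.exists_ne_zero_of_sum_ne_zero ((hp.2 S).trans_ne one_ne_zero)
  exact ⟨i, i.2⟩

lemma IsChoiceCollection.eq_zero_of_ne {i j : {i : Fin n // i ∈ S.1}} (hi : p ⟨S, i⟩ = 1)
    (hij : j ≠ i) : p ⟨S, j⟩ = 0 := by
  classical
  have hpair := Finset.sum_le_sum_of_subset_of_nonneg (f := fun i => p ⟨S, i⟩)
    (Finset.subset_univ {j, i}) fun _ _ _ => hp.1 _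
  rw [hp.2 S, Finset.sum_pair hij] at hpair
  linarith [hp.1 ⟨S, j⟩]

lemma IsChoiceCollection.eq_one_of_card_le_one (hS : S.1.card ≤ 1) (i : {i : Fin n // i ∈ S.1}) :
    p ⟨S, i⟩ = 1 := by
  have : Subsingleton {i : Fin n // i ∈ S.1} := Finset.card_le_one_iff_subsingleton_coe.1 hS
  rw [← hp.2 S, Fintype.sum_subsingleton _ i]

end ChoiceCollection

lemma MDMYields.exists_real_Ioi_eq (hF : ∀ i, IsAdmissibleMarginal (F i)) (hy : MDMYields F ν p)
    (hS : 1 < S.1.card) :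
    ∃ l, ∀ i : {i : Fin n // i ∈ S.1}, (F i).real (Ioi (l - ν i)) = p ⟨S, i⟩ := by
  have := fun i => (hF i).isProbabilityMeasure
  have := fun i => (hF i).nullSingletonClass
  obtain ⟨l, hl⟩ := exists_sum_real_Ioi_eq (F := F) ν one_pos (Nat.one_lt_cast.2 hS)
  obtain ⟨hne, θ, hθ, hmax, hprob⟩ := hy S
  refine ⟨l, fun i => ?_⟩
  rw [hprob i, measureReal_argmaxEvent_of_isMaxOn (fun i => (hF i).integrable_id) hl hθ hne hmax
    i.2]

-- At a product chosen with probability one, a level with tail exactly one need not be unique; the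
-- cap `q` replaces it by a level at which the tail lies strictly between `0` and `1`.
lemma MDMYields.exists_real_Ioi_eq_min (hp : IsChoiceCollection p)
    (hF : ∀ i, IsAdmissibleMarginal (F i)) (hy : MDMYields F ν p) {q : ℝ} (hq : q ∈ Ioo 0 1)
    (hpq : ∀ x, p x < 1 → p x < q) (S : {S : Finset (Fin n) // S ∈ 𝒮}) :
    ∃ l, ∀ i : {i : Fin n // i ∈ S.1}, (F i).real (Ioi (l - ν i)) = min (p ⟨S, i⟩) q := by
  have := fun i => (hF i).isProbabilityMeasure
  have := fun i => (hF i).nullSingletonClass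
  by_cases hone : ∃ i, p ⟨S, i⟩ = 1
  · obtain ⟨i, hi⟩ := hone
    obtain ⟨l, hl⟩ : ∃ l, (F i).real (Ioi (l - ν i)) = q := by
      simpa using exists_sum_real_Ioi_eq (F := F) ν (S := {i.1}) hq.1 (by simpa using hq.2)
    refine ⟨l, fun j => ?_⟩
    rcases eq_or_ne j i with rfl | hji
    · rw [hl, hi, min_eq_right hq.2.le]
    have hj := hp.eq_zero_of_ne hi hji
    obtain ⟨l₀, hl₀⟩ := hy.exists_real_Ioi_eq hF (S := S)
      (Finset.one_lt_card.2 ⟨j, j.2, i, i.2, Subtype.coe_ne_coe.2 hji⟩)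
    have hle : l₀ ≤ l := not_lt.1 fun hlt => by
      have htail : (F i).real (Ioi (l₀ - ν i)) ≤ (F i).real (Ioi (l - ν i)) :=
        antitone_real_Ioi (sub_le_sub_right hlt.le _)
      rw [hl₀, hi, hl] at htail
      exact hq.2.not_ge htail
    have htail : (F j).real (Ioi (l - ν j)) ≤ (F j).real (Ioi (l₀ - ν j)) :=
      antitone_real_Ioi (sub_le_sub_right hle _)
    rw [hl₀, hj] at htail
    rw [hj, min_eq_left hq.1.le, htail.antisymm measureReal_nonneg]
  · have hlt (i : {i : Fin n // i ∈ S.1}) : p ⟨S, i⟩ < 1 :=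
      (hp.le_one _).lt_of_ne fun h => hone ⟨i, h⟩
    obtain ⟨i, hi⟩ := hp.nonempty S
    obtain ⟨l, hl⟩ := hy.exists_real_Ioi_eq hF (S := S) (not_le.1 fun hcard =>
      hone ⟨⟨i, hi⟩, hp.eq_one_of_card_le_one hcard _⟩)
    exact ⟨l, fun i => by rw [hl, min_eq_left (hpq _ (hlt i)).le]⟩

/-- The levels `lam` and utilities `ν` solve the system of the representability criterion: within a
group, the thresholds `lam S - ν i` decrease strictly in the choice probability, and pairs with
equal nonzero probability have equal thresholds. -/
def IsSeparating (g : Fin n → Fin K) (p : Pairs 𝒮 → ℝ)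
    (lam : {S : Finset (Fin n) // S ∈ 𝒮} → ℝ) (ν : Fin n → ℝ) : Prop :=
  ∀ x y : Pairs 𝒮, g x.product = g y.product →
    (p x < p y → lam x.assortment - ν x.product > lam y.assortment - ν y.product) ∧
    (p x = p y ∧ p x ≠ 0 →
      lam x.assortment - ν x.product = lam y.assortment - ν y.product)

theorem IsGroupedRepresentable.exists_isSeparating (hp : IsChoiceCollection p)
    (h : IsGroupedRepresentable g p) : ∃ lam ν, IsSeparating g p lam ν := by
  obtain ⟨F, ν, hF, ⟨Fhat, hFhat⟩, hy⟩ := h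
  obtain ⟨q, hpq, hq⟩ : ∃ q : ℝ, (∀ x, p x < 1 → p x < q) ∧ q ∈ Ioo 0 1 := by
    refine Eventually.exists (f := 𝓝[<] (1 : ℝ)) (.and ?_ (Ioo_mem_nhdsLT one_pos))
    refine eventually_all.2 fun x => ?_
    by_cases hx : p x < 1
    · filter_upwards [Ioo_mem_nhdsLT hx] with q hq _ using hq.1
    · exact .of_forall fun _ h => absurd h hx
  choose lam hlam using fun S => hy.exists_real_Ioi_eq_min hp hF hq hpq S
  have htail (x : Pairs 𝒮) :
      (F x.product).real (Ioi (lam x.assortment - ν x.product)) = min (p x) q := hlam x.1 x.2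
  refine ⟨lam, ν, fun x y hxy => ?_⟩
  have := (hF x.product).isProbabilityMeasure
  have := (hF x.product).nullSingletonClass
  have hFxy : F y.product = F x.product := by rw [hFhat, hFhat, hxy]
  have hty := htail y
  rw [hFxy] at hty
  constructor
  · intro hlt
    refine antitone_real_Ioi.reflect_lt ((htail x).trans_lt (lt_of_lt_of_eq ?_ hty.symm))
    have hxq := hpq x (hlt.trans_le (hp.le_one y))
    exact (min_eq_left hxq.le).trans_lt (lt_min hlt hxq)
  · rintro ⟨heq, hne⟩
    have hmem : min (p x) q ∈ Ioo 0 1 :=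
      ⟨lt_min ((hp.1 x).lt_of_ne' hne) hq.1, min_lt_of_right_lt hq.2⟩
    refine (strictAntiOn_real_Ioi (hF x.product).strictMonoOn_cdf).injOn ?_ ?_
      ((htail x).trans (heq ▸ hty.symm))
    · rwa [mem_preimage, htail]
    · rwa [mem_preimage, hty, ← heq]

lemma mdmYields_of_real_Ioi_eq (hp : IsChoiceCollection p) (hF : ∀ i, IsAdmissibleMarginal (F i))
    {lam : {S : Finset (Fin n) // S ∈ 𝒮} → ℝ}
    (htail : ∀ x : Pairs 𝒮,
      (F x.product).real (Ioi (lam x.assortment - ν x.product)) = p x) :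
    MDMYields F ν p := by
  intro S
  have := fun i => (hF i).isProbabilityMeasure
  have := fun i => (hF i).nullSingletonClass
  have hint := fun i => (hF i).integrable_id
  have hS := hp.nonempty S
  have hl : ∑ i ∈ S.1, (F i).real (Ioi (lam S - ν i)) = 1 := by
    rw [← hp.2 S, ← Finset.sum_coe_sort]
    exact Finset.sum_congr rfl fun i _ => htail ⟨S, i⟩
  obtain ⟨θ, hθ, hmax⟩ := exists_isMaxOn_expectedMaxUtility hint hl hS
  exact ⟨hS, θ, hθ, hmax, fun i => by
    rw [measureReal_argmaxEvent_of_isMaxOn hint hl hθ hS hmax i.2, ← htail ⟨S, i⟩]⟩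

theorem IsSeparating.isDistinctGroupedRepresentable (hp : IsChoiceCollection p)
    {lam : {S : Finset (Fin n) // S ∈ 𝒮} → ℝ} (h : IsSeparating g p lam ν) :
    IsDistinctGroupedRepresentable g p := by
  have hlaw (G : Fin K) : ∃ F : Measure ℝ, IsAdmissibleMarginal F ∧
      ∀ x : {x : Pairs 𝒮 // g x.product = G},
        F.real (Ioi (lam x.1.assortment - ν x.1.product)) = p x.1 :=
    exists_isAdmissibleMarginal_real_Ioi_eq (fun x => ⟨hp.1 _, hp.le_one _⟩)
      (fun x y => (h x.1 y.1 (x.2.trans y.2.symm)).1)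
      fun x y heq hne => (h x.1 y.1 (x.2.trans y.2.symm)).2 ⟨heq, hne⟩
  choose Fhat hFhat htail using hlaw
  have := fun G => (hFhat G).isProbabilityMeasure
  obtain ⟨t, ht⟩ := exists_injective_map_add_right fun G => (hFhat G).integrable_id
  have hF (i : Fin n) := (hFhat (g i)).map_add_right (t (g i))
  refine ⟨_, fun i => ν i - t (g i), hF, ⟨_, ht, fun _ => rfl⟩,
    mdmYields_of_real_Ioi_eq hp hF (lam := lam) fun x => ?_⟩
  rw [real_Ioi_map_add_right, sub_sub, sub_add_cancel]
  exact htail _ ⟨x, rfl⟩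

lemma IsDistinctGroupedRepresentable.isGroupedRepresentable
    (h : IsDistinctGroupedRepresentable g p) : IsGroupedRepresentable g p := by
  obtain ⟨F, ν, hF, ⟨Fhat, -, hFhat⟩, hy⟩ := h
  exact ⟨F, ν, hF, ⟨Fhat, hFhat⟩, hy⟩

end Characterization


section Program

variable {n K : ℕ} {g : Fin n → Fin K} {𝒮 : Finset (Finset (Fin n))} {p : Pairs 𝒮 → ℝ}

lemma sum_gapCoeff_mul (x y : Pairs 𝒮) (a : TestVar 𝒮 → ℝ) :
    ∑ v, gapCoeff x y v * a v =
      (a (Sum.inl x.assortment) - a (Sum.inr (Sum.inl x.product))) -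
        (a (Sum.inl y.assortment) - a (Sum.inr (Sum.inl y.product))) := by
  simp only [gapCoeff, Pi.sub_apply, sub_mul, Finset.sum_sub_distrib, Pi.single_apply, ite_mul,
    one_mul, zero_mul, Finset.sum_ite_eq', Finset.mem_univ, if_true]

lemma sum_epsCoeff_mul (a : TestVar 𝒮 → ℝ) :
    ∑ v, epsCoeff 𝒮 v * a v = a (Sum.inr (Sum.inr ())) := by
  simp only [epsCoeff, Pi.single_apply, ite_mul, one_mul, zero_mul, Finset.sum_ite_eq',
    Finset.mem_univ, if_true]

lemma mem_feasible_testProgram_iff (a : TestVar 𝒮 → ℝ) :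
    a ∈ (testProgram g p).feasible ↔
      (∀ x y : Pairs 𝒮, g x.product = g y.product → p x < p y →
        a (Sum.inr (Sum.inr ())) ≤
          (a (Sum.inl x.assortment) - a (Sum.inr (Sum.inl x.product))) -
            (a (Sum.inl y.assortment) - a (Sum.inr (Sum.inl y.product)))) ∧
      ∀ x y : Pairs 𝒮, g x.product = g y.product → p x = p y → p x ≠ 0 →
        (a (Sum.inl x.assortment) - a (Sum.inr (Sum.inl x.product))) -
          (a (Sum.inl y.assortment) - a (Sum.inr (Sum.inl y.product))) = 0 := by
  simp only [LinearProgram.feasible, testProgram, Set.mem_ofPred_eq, Pi.sub_apply, sub_mul,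
    Finset.sum_sub_distrib, sum_gapCoeff_mul, sum_epsCoeff_mul, Subtype.forall, Prod.forall,
    and_imp, sub_nonneg]

lemma IsSeparating.exists_pos_le {lam : {S : Finset (Fin n) // S ∈ 𝒮} → ℝ} {ν : Fin n → ℝ}
    (h : IsSeparating g p lam ν) :
    ∃ e > 0, ∀ x y : Pairs 𝒮, g x.product = g y.product → p x < p y →
      e ≤ (lam x.assortment - ν x.product) - (lam y.assortment - ν y.product) := by
  have hgap (c : StrictRows g p) : 0 <
      (lam c.1.1.assortment - ν c.1.1.product) - (lam c.1.2.assortment - ν c.1.2.product) :=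
    sub_pos.2 ((h c.1.1 c.1.2 c.2.1).1 c.2.2)
  have hsmall : ∀ᶠ e in 𝓝[>] (0 : ℝ), ∀ c : StrictRows g p, e ≤
      (lam c.1.1.assortment - ν c.1.1.product) - (lam c.1.2.assortment - ν c.1.2.product) :=
    eventually_all.2 fun c => eventually_of_mem (Ioc_mem_nhdsGT (hgap c)) fun _ he => he.2
  obtain ⟨e, he, hpos⟩ := (hsmall.and self_mem_nhdsWithin).exists
  exact ⟨e, hpos, fun x y hxy hlt => he ⟨(x, y), hxy, hlt⟩⟩

theorem testProgram_value_pos_iff :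
    0 < (testProgram g p).value ↔ ∃ lam ν, IsSeparating g p lam ν := by
  have hvalue : 0 < (testProgram g p).value ↔
      ∃ a ∈ (testProgram g p).feasible, 0 < a (Sum.inr (Sum.inr ())) := by
    simp only [LinearProgram.value, lt_iSup_iff, testProgram, sum_epsCoeff_mul, exists_prop,
      EReal.coe_pos]
  simp only [hvalue, mem_feasible_testProgram_iff]
  constructor
  · rintro ⟨a, ⟨hstrict, htie⟩, hpos⟩
    exact ⟨fun S => a (Sum.inl S), fun i => a (Sum.inr (Sum.inl i)), fun x y hxy =>
      ⟨fun hlt => sub_pos.1 (hpos.trans_le (hstrict x y hxy hlt)),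
        fun ⟨heq, hne⟩ => sub_eq_zero.1 (htie x y hxy heq hne)⟩⟩
  · rintro ⟨lam, ν, h⟩
    obtain ⟨e, hpos, he⟩ := h.exists_pos_le
    exact ⟨Sum.elim lam (Sum.elim ν fun _ => e),
      ⟨he, fun x y hxy heq hne => sub_eq_zero.2 ((h x y hxy).2 ⟨heq, hne⟩)⟩, hpos⟩

lemma numVars_testProgram : (testProgram g p).numVars = 𝒮.card + (n + 1) := by
  simp [LinearProgram.numVars]

theorem numVars_testProgram_le (hp : IsChoiceCollection p) (h𝒮 : 𝒮.Nonempty) :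
    (testProgram g p).numVars ≤ 3 * (n * 𝒮.card) := by
  have hn : 0 < n := by
    obtain ⟨S, hS⟩ := h𝒮
    obtain ⟨i, -⟩ := hp.nonempty ⟨S, hS⟩
    exact i.pos
  have hcard : 𝒮.card ≤ n * 𝒮.card := Nat.le_mul_of_pos_left _ hn
  have hprod : n ≤ n * 𝒮.card := Nat.le_mul_of_pos_right _ h𝒮.card_pos
  rw [numVars_testProgram]
  lia

lemma card_pairs_le (𝒮 : Finset (Finset (Fin n))) : Nat.card (Pairs 𝒮) ≤ n * 𝒮.card := by
  have hinj : Function.Injective fun x : Pairs 𝒮 => (x.product, x.assortment) := by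
    rintro ⟨S, i⟩ ⟨T, j⟩ h
    obtain ⟨hij, hST⟩ := Prod.mk.inj h
    obtain rfl : S = T := hST
    exact congrArg (Sigma.mk S) (Subtype.ext hij)
  refine (Nat.card_le_card_of_injective _ hinj).trans_eq ?_
  simp

theorem numConstraints_testProgram_le :
    (testProgram g p).numConstraints ≤ n ^ 2 * 𝒮.card ^ 2 := by
  have hinj : Function.Injective
      (Sum.elim Subtype.val Subtype.val : StrictRows g p ⊕ TieRows g p → Pairs 𝒮 × Pairs 𝒮) :=
    Subtype.val_injective.sumElim Subtype.val_injective fun c d h =>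
      (h ▸ c.2.2).ne d.2.2.1
  calc (testProgram g p).numConstraints
      = Nat.card (StrictRows g p ⊕ TieRows g p) := Nat.card_sum.symm
    _ ≤ Nat.card (Pairs 𝒮 × Pairs 𝒮) := Nat.card_le_card_of_injective _ hinj
    _ = Nat.card (Pairs 𝒮) * Nat.card (Pairs 𝒮) := Nat.card_prod _ _
    _ ≤ (n * 𝒮.card) * (n * 𝒮.card) := Nat.mul_le_mul (card_pairs_le 𝒮) (card_pairs_le 𝒮)
    _ = n ^ 2 * 𝒮.card ^ 2 := by ring

end Program

end ChoiceModel

theorem theorem5 {n K : ℕ} (g : Fin n → Fin K) (𝒮 : Finset (Finset (Fin n)))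
    (p : ChoiceModel.Pairs 𝒮 → ℝ) (hp : ChoiceModel.IsChoiceCollection p) :
    (ChoiceModel.IsGroupedRepresentable g p ↔
      ∃ (lam : {S : Finset (Fin n) // S ∈ 𝒮} → ℝ) (ν : Fin n → ℝ),
        ∀ x y : ChoiceModel.Pairs 𝒮, g x.product = g y.product →
          (p x < p y → lam x.assortment - ν x.product > lam y.assortment - ν y.product) ∧
          (p x = p y ∧ p x ≠ 0 →
            lam x.assortment - ν x.product = lam y.assortment - ν y.product)) ∧
    (ChoiceModel.IsDistinctGroupedRepresentable g p ↔
      ChoiceModel.IsGroupedRepresentable g p) ∧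
    (ChoiceModel.IsGroupedRepresentable g p ↔ 0 < (ChoiceModel.testProgram g p).value) ∧
    (𝒮.Nonempty → (ChoiceModel.testProgram g p).numVars ≤ 3 * (n * 𝒮.card)) ∧
    (ChoiceModel.testProgram g p).numConstraints ≤ n ^ 2 * 𝒮.card ^ 2 := by
  have hiff : ChoiceModel.IsGroupedRepresentable g p ↔
      ∃ lam ν, ChoiceModel.IsSeparating g p lam ν :=
    ⟨fun h => h.exists_isSeparating hp, fun ⟨_, _, h⟩ =>
      (h.isDistinctGroupedRepresentable hp).isGroupedRepresentable⟩
  have hdistinct (h : ChoiceModel.IsGroupedRepresentable g p) :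
      ChoiceModel.IsDistinctGroupedRepresentable g p :=
    let ⟨_, _, hsep⟩ := h.exists_isSeparating hp
    hsep.isDistinctGroupedRepresentable hp
  exact ⟨hiff, ⟨fun h => h.isGroupedRepresentable, hdistinct⟩,
    hiff.trans ChoiceModel.testProgram_value_pos_iff.symm,
    ChoiceModel.numVars_testProgram_le hp, ChoiceModel.numConstraints_testProgram_le⟩
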